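/- For a function $\phi:\mathbb{R}\to\mathbb{R}$ and $d\ge 1$, let $\mathcal{S}_{d}(\phi)$ be the set of functions on $\mathbb{R}^{d}$ represented by a shallow $\phi$ network, i.e. of the form $$F(x)=\sum_{i=1}^{k}t_i\,\phi(\langle y_i,x\rangle+\varrho_i),\qquad k\in\mathbb{N},\ t_i,\varrho_i\in\mathbb{R},\ y_i\in\mathbb{R}^{d}.$$ Null sets are meant with respect to Lebesgue measure, and "monotone" means non-decreasing or non-increasing. **Theorem 3.5.** Let $n\in\mathbb{N}$, $\Omega=\mathbb{R}\times[0,1]^n\subset\mathbb{R}^{n+1}$ and $2\le p<\infty$. Let $\phi:\mathbb{R}\to\mathbb{R}$ be a (Lebesgue) measurable function such that 1. $\phi$ is essentially bounded, i.e. bounded outside some null set; 2. $\phi$ is eventually essentially monotone, i.e. there are $X>0$ and null sets $Z_1,Z_2\subset\mathbb{R}$ such that $\phi$ is monotone on $(X,\infty)\setminus Z_1$ and monotone on $(-\infty,-X)\setminus Z_2$ (the two directions of monotonicity may differ); 3. $\phi$ has different a.e. limits at $+\infty$ and $-\infty$, i.e. there are real numbers $a\ne b$ and null sets $Z_+,Z_-\subset\mathbb{R}$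 such that $\phi(t)\to a$ as $t\to+\infty$, $t\notin Z_+$, and $\phi(t)\to b$ as $t\to-\infty$, $t\notin Z_-$. Then the shallow $\phi$ networks are dense in the real space $L^p(\Omega)$ (with Lebesgue measure): $$\overline{\mathcal{S}_{n+1}(\phi)\cap L^{p}(\Omega)}=L^{p}(\Omega),$$ where $\mathcal{S}_{n+1}(\phi)\cap L^{p}(\Omega)$ is the set of elements of $L^p(\Omega)$ that agree almost everywhere on $\Omega$ with some $F\in\mathcal{S}_{n+1}(\phi)$, and the closure is taken in the $L^p(\Omega)$ norm. -/

import Mathlib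

open MeasureTheory Filter Topology
open scoped ENNReal

namespace ShallowNet

/-- `φ` is bounded on `s`. -/
def IsBoundedOn (φ : ℝ → ℝ) (s : Set ℝ) : Prop :=
  ∃ C : ℝ, ∀ x ∈ s, |φ x| ≤ C

/-- `φ` is monotone on `s`, that is, non-decreasing on `s` or non-increasing on `s`. -/
def IsMonotoneOn (φ : ℝ → ℝ) (s : Set ℝ) : Prop :=
  MonotoneOn φ s ∨ AntitoneOn φ s

/-- `φ`, restricted to `U`, is essentially `P`: it is `P` on `U \ Z` for some Lebesgue null
set `Z`. -/
def EssentiallyOn (P : (ℝ → ℝ) → Set ℝ → Prop) (φ : ℝ → ℝ) (U : Set ℝ) : Prop :=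
  ∃ Z : Set ℝ, volume Z = 0 ∧ P φ (U \ Z)

/-- `φ` is eventually essentially `P`: for some `X > 0` it is essentially `P` on `(X, ∞)` and
on `(-∞, -X)`. -/
def EventuallyEssentially (P : (ℝ → ℝ) → Set ℝ → Prop) (φ : ℝ → ℝ) : Prop :=
  ∃ X : ℝ, 0 < X ∧ EssentiallyOn P φ (Set.Ioi X) ∧ EssentiallyOn P φ (Set.Iio (-X))

/-- `φ` tends to `c` along `l` almost everywhere: for some Lebesgue null set `Z`, `φ t` tends
to `c` along `l` with `t ∉ Z`. -/
def HasAELimit (φ : ℝ → ℝ) (l : Filter ℝ) (c : ℝ) : Prop :=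
  ∃ Z : Set ℝ, volume Z = 0 ∧ Tendsto φ (l ⊓ 𝓟 Zᶜ) (𝓝 c)

/-- The neuron `x ↦ φ (⟨y, x⟩ + ϱ)` on `ℝ^d`. -/
noncomputable def neuron {d : ℕ} (φ : ℝ → ℝ) (ϱ : ℝ) (y : EuclideanSpace ℝ (Fin d)) :
    EuclideanSpace ℝ (Fin d) → ℝ :=
  fun x => φ (inner ℝ y x + ϱ)

/-- The set of all functions on `ℝ^d` that are represented by a shallow `φ` network. -/
def shallowNetworks (d : ℕ) (φ : ℝ → ℝ) : Set (EuclideanSpace ℝ (Fin d) → ℝ) :=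
  {F | ∃ (k : ℕ) (y : Fin k → EuclideanSpace ℝ (Fin d)) (t ϱ : Fin k → ℝ),
    F = fun x => ∑ i, t i * neuron φ (ϱ i) (y i) x}

/-- The elements of `L^p(Ω)` (real-valued, with respect to Lebesgue measure on `Ω`) that are
represented by a shallow `φ` network. -/
def networksInLp {d : ℕ} (φ : ℝ → ℝ) (Ω : Set (EuclideanSpace ℝ (Fin d))) (p : ℝ≥0∞) :
    Set (Lp ℝ p (volume.restrict Ω)) :=
  {f | ∃ F ∈ shallowNetworks d φ, f =ᵐ[volume.restrict Ω] F}

/-- The shallow `φ` network is a universal approximator in `L^p(Ω)`: the closure, for the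
`L^p` norm, of the set of networks in `L^p(Ω)` is all of `L^p(Ω)`. -/
def IsUniversalApproximator {d : ℕ} (φ : ℝ → ℝ) (Ω : Set (EuclideanSpace ℝ (Fin d)))
    (p : ℝ≥0∞) [Fact (1 ≤ p)] : Prop :=
  closure (networksInLp φ Ω p) = Set.univ

/-- The set `ℝ × [0,1]^n` in `ℝ^(n+1)`. -/
def lineTimesCube (n : ℕ) : Set (EuclideanSpace ℝ (Fin (n + 1))) :=
  {x | ∀ i : Fin n, x i.succ ∈ Set.Icc (0 : ℝ) 1}

end ShallowNet

/-! If `v 0 = 1`, the map `x ↦ ⟨v, x⟩` carries Lebesgue measure on `ℝ × [0,1]^n` to Lebesgue measure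
on `ℝ`, because it is a shear in the first variable and the cube has volume `1`. Every one-variable
approximation in `L^p(ℝ)` therefore lifts isometrically to ridge functions on the strip
(`measurePreserving_inner`, `comp_mem_lpClosure`).

In one variable, `φ(r(t - c)) - φ(r(t - d))` tends to `(a - b)` times the indicator of `(c, d]` in
`L^p` as `r → ∞`. The deviation of `φ` from its limiting jump need not be integrable, but
monotonicity of the tails makes its difference with a translate by `R` have `L^1` norm `o(R)`, and
rescaling turns this into `o(1)`. Boundedness upgrades `L^1` to `L^p`. Step functions then give all
of `C_c(ℝ)`.

To leave the ridge functions, `F(⟨v, x⟩)` is differentiated in `v`, which produces `F'(⟨v, x⟩) xᵢ`.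
For `1 < p < ∞` derivatives of test functions are `L^p` dense in the test functions, so
multiplication by `xᵢ` preserves approximability (`IsRidgeMultiplier.coord_mul`). Iterating gives
`f(x₀)` times any polynomial, and Stone–Weierstrass finishes. -/

namespace ShallowNet

/-! ### Approximation in `L^p` by elements of a space of functions. -/

section Approximation

variable {α β : Type*} [MeasurableSpace α] [MeasurableSpace β]

/-- The functions in `L^p(μ)` that can be approximated, in the `L^p` seminorm, by elements of
the space `S` of functions. -/
def lpClosure (S : Submodule ℝ (α → ℝ)) (p : ℝ≥0∞) [hp : Fact (1 ≤ p)] (μ : Measure α) :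
    Submodule ℝ (α → ℝ) where
  carrier := {F | MemLp F p μ ∧
    ∀ ε : ℝ≥0∞, ε ≠ 0 → ∃ G ∈ S, MemLp G p μ ∧ eLpNorm (F - G) p μ ≤ ε}
  zero_mem' := ⟨MemLp.zero, fun ε _ => ⟨0, S.zero_mem, MemLp.zero, by simp⟩⟩
  add_mem' := by
    rintro F F' ⟨hF, h⟩ ⟨hF', h'⟩
    refine ⟨hF.add hF', fun ε hε => ?_⟩
    obtain ⟨G, hGS, hG, hGε⟩ := h (ε / 2) (by simpa using hε)
    obtain ⟨G', hGS', hG', hGε'⟩ := h' (ε / 2) (by simpa using hε)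
    refine ⟨G + G', S.add_mem hGS hGS', hG.add hG', ?_⟩
    rw [add_sub_add_comm]
    refine (eLpNorm_add_le (hF.sub hG).1 (hF'.sub hG').1 hp.out).trans ?_
    exact (add_le_add hGε hGε').trans (ENNReal.add_halves ε).le
  smul_mem' := by
    rintro c F ⟨hF, h⟩
    refine ⟨hF.const_smul c, fun ε hε => ?_⟩
    obtain ⟨G, hGS, hG, hGε⟩ := h (ε / ‖c‖ₑ) (by simp [hε])
    refine ⟨c • G, S.smul_mem c hGS, hG.const_smul c, ?_⟩
    rw [← smul_sub, eLpNorm_const_smul]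
    exact (mul_le_mul_right hGε _).trans ENNReal.mul_div_le

variable {S : Submodule ℝ (α → ℝ)} {p : ℝ≥0∞} [hp : Fact (1 ≤ p)] {μ : Measure α} {F : α → ℝ}

theorem mem_lpClosure_of_mem (hF : F ∈ S) (h : MemLp F p μ) : F ∈ lpClosure S p μ :=
  ⟨h, fun _ _ => ⟨F, hF, h, by simp⟩⟩

theorem mem_lpClosure_of_approx (hF : MemLp F p μ)
    (h : ∀ ε : ℝ≥0∞, ε ≠ 0 → ∃ G ∈ lpClosure S p μ, eLpNorm (F - G) p μ ≤ ε) :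
    F ∈ lpClosure S p μ := by
  refine ⟨hF, fun ε hε => ?_⟩
  obtain ⟨G, ⟨hG, hG'⟩, hGε⟩ := h (ε / 2) (by simpa using hε)
  obtain ⟨K, hKS, hK, hKε⟩ := hG' (ε / 2) (by simpa using hε)
  refine ⟨K, hKS, hK, ?_⟩
  rw [← sub_add_sub_cancel F G K]
  refine (eLpNorm_add_le (hF.sub hG).1 (hG.sub hK).1 hp.out).trans ?_
  exact (add_le_add hGε hKε).trans (ENNReal.add_halves ε).le

theorem mem_lpClosure_of_tendsto {ι : Type*} {l : Filter ι} [l.NeBot] {G : ι → α → ℝ}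
    (hF : MemLp F p μ) (hG : ∀ᶠ i in l, G i ∈ lpClosure S p μ)
    (h : Tendsto (fun i => eLpNorm (F - G i) p μ) l (𝓝 0)) : F ∈ lpClosure S p μ := by
  refine mem_lpClosure_of_approx hF fun ε hε => ?_
  obtain ⟨i, hi, hi'⟩ := (hG.and (h.eventually_le_const (pos_iff_ne_zero.2 hε))).exists
  exact ⟨G i, hi, hi'⟩

/-- Approximability is preserved by composition with a measure preserving map. -/
theorem comp_mem_lpClosure {ν : Measure β} {T : Submodule ℝ (β → ℝ)} {g : α → β}
    (hg : MeasurePreserving g μ ν) (hTS : ∀ G ∈ T, G ∘ g ∈ S) {f : β → ℝ}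
    (hf : f ∈ lpClosure T p ν) : f ∘ g ∈ lpClosure S p μ := by
  refine ⟨hf.1.comp_measurePreserving hg, fun ε hε => ?_⟩
  obtain ⟨G, hGT, hG, hGε⟩ := hf.2 ε hε
  refine ⟨G ∘ g, hTS G hGT, hG.comp_measurePreserving hg, ?_⟩
  have : f ∘ g - G ∘ g = (f - G) ∘ g := rfl
  rw [this, eLpNorm_comp_measurePreserving (hf.1.sub hG).1 hg]
  exact hGε

/-- Interpolation between an essential bound and the `L^1` seminorm. -/
theorem eLpNorm_le_interpolate (hp' : p ≠ ∞) {C : ℝ≥0∞} (hCt : C ≠ ∞)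
    (hC : ∀ᵐ x ∂μ, ‖F x‖ₑ ≤ C) :
    eLpNorm F p μ ≤ (C ^ (p.toReal - 1) * ∫⁻ x, ‖F x‖ₑ ∂μ) ^ (1 / p.toReal) := by
  have h0 : p ≠ 0 := (zero_lt_one.trans_le hp.out).ne'
  have h1 : 1 ≤ p.toReal := by
    simpa using (ENNReal.toReal_le_toReal ENNReal.one_ne_top hp').2 hp.out
  rw [eLpNorm_eq_lintegral_rpow_enorm_toReal h0 hp']
  gcongr
  rw [← lintegral_const_mul' _ _ (by finiteness)]
  refine lintegral_mono_ae (hC.mono fun x hx => ?_)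
  calc ‖F x‖ₑ ^ p.toReal = ‖F x‖ₑ ^ (p.toReal - 1) * ‖F x‖ₑ ^ (1 : ℝ) := by
        rw [← ENNReal.rpow_add_of_nonneg _ _ (by linarith) zero_le_one, sub_add_cancel]
    _ ≤ C ^ (p.toReal - 1) * ‖F x‖ₑ := by
        rw [ENNReal.rpow_one]
        gcongr

theorem tendsto_eLpNorm_of_tendsto_lintegral (hp' : p ≠ ∞) {ι : Type*} {l : Filter ι}
    {E : ι → α → ℝ} {C : ℝ≥0∞} (hCt : C ≠ ∞) (hC : ∀ i, ∀ᵐ x ∂μ, ‖E i x‖ₑ ≤ C)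
    (h : Tendsto (fun i => ∫⁻ x, ‖E i x‖ₑ ∂μ) l (𝓝 0)) :
    Tendsto (fun i => eLpNorm (E i) p μ) l (𝓝 0) := by
  have h1 : 1 ≤ p.toReal := by
    simpa using (ENNReal.toReal_le_toReal ENNReal.one_ne_top hp').2 hp.out
  refine tendsto_of_tendsto_of_tendsto_of_le_of_le tendsto_const_nhds ?_ (fun _ => zero_le)
    fun i => eLpNorm_le_interpolate hp' hCt (hC i)
  have h2 := ENNReal.Tendsto.const_mul (a := C ^ (p.toReal - 1)) h (Or.inr (by finiteness))
  have h3 := ((ENNReal.continuous_rpow_const (y := 1 / p.toReal)).tendsto _).comp h2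
  have h4 : 0 < p.toReal := by linarith
  simpa [h4, Function.comp_def] using h3

/-- On a space of infinite measure uniform closeness does not control the `L^p` norm; the fixed
weight `k` in `L^p` makes it do so. -/
theorem mem_lpClosure_of_forall_le (hF : MemLp F p μ) {k : α → ℝ} (hk : MemLp k p μ)
    (h : ∀ δ : ℝ, 0 < δ → ∃ G ∈ lpClosure S p μ, ∀ᵐ x ∂μ, |F x - G x| ≤ δ * k x) :
    F ∈ lpClosure S p μ := by
  refine mem_lpClosure_of_approx hF fun ε hε => ?_
  have hlim : Tendsto (fun δ : ℝ => ENNReal.ofReal δ * eLpNorm k p μ) (𝓝[>] 0) (𝓝 0) := by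
    have h1 : Tendsto (fun δ : ℝ => ENNReal.ofReal δ) (𝓝[>] 0) (𝓝 (ENNReal.ofReal 0)) :=
      (ENNReal.continuous_ofReal.tendsto 0).mono_left nhdsWithin_le_nhds
    simpa using ENNReal.Tendsto.mul_const h1 (Or.inr hk.2.ne)
  obtain ⟨δ, hδ, hδ0⟩ := ((hlim.eventually_le_const (pos_iff_ne_zero.2 hε)).and
    self_mem_nhdsWithin).exists
  obtain ⟨G, hG, hGk⟩ := h δ hδ0
  refine ⟨G, hG, (eLpNorm_mono_ae_real (g := δ • k) ?_).trans ?_⟩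
  · filter_upwards [hGk] with x hx using hx
  · rwa [eLpNorm_const_smul, Real.enorm_of_nonneg (le_of_lt hδ0)]

end Approximation

/-! ### Translation differences of slowly decaying functions. -/

section ShiftDifference

/-- The `L^1` norm of the difference of `D` and its translate by `R` is `o(R)` as `R → ∞`. -/
def ShiftSublinear (D : ℝ → ℝ) : Prop :=
  ∀ ε : ℝ, 0 < ε → ∀ᶠ R : ℝ in atTop, ∫⁻ t, ‖D t - D (t - R)‖ₑ ≤ ENNReal.ofReal (ε * R)

theorem ShiftSublinear.congr_ae {D D' : ℝ → ℝ} (h : ShiftSublinear D) (hD : D =ᵐ[volume] D') :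
    ShiftSublinear D' := by
  intro ε hε
  filter_upwards [h ε hε] with R hR
  refine le_of_eq_of_le (lintegral_congr_ae ?_) hR
  have : ∀ᵐ t : ℝ, D (t - R) = D' (t - R) :=
    (measurePreserving_sub_right volume R).quasiMeasurePreserving.ae hD
  filter_upwards [hD, this] with t h1 h2
  rw [h1, h2]

theorem ShiftSublinear.neg {D : ℝ → ℝ} (h : ShiftSublinear D) :
    ShiftSublinear (fun t => -D t) := by
  intro ε hε
  filter_upwards [h ε hε] with R hR
  refine le_of_eq_of_le (lintegral_congr fun t => ?_) hR
  rw [← enorm_neg]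
  congr 1
  ring

theorem ShiftSublinear.comp_neg {D : ℝ → ℝ} (h : ShiftSublinear D) :
    ShiftSublinear (fun t => D (-t)) := by
  intro ε hε
  filter_upwards [h ε hε] with R hR
  refine le_of_eq_of_le ?_ hR
  rw [← lintegral_sub_left_eq_self (fun t => ‖D t - D (t - R)‖ₑ) R]
  refine lintegral_congr fun t => ?_
  rw [← enorm_neg]
  congr 1
  ring_nf

theorem ShiftSublinear.add {D D' : ℝ → ℝ} (h : ShiftSublinear D) (h' : ShiftSublinear D')
    (hm : Measurable D) : ShiftSublinear (fun t => D t + D' t) := by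
  intro ε hε
  filter_upwards [h (ε / 2) (by positivity), h' (ε / 2) (by positivity), eventually_ge_atTop 0]
    with R hR hR' hR0
  calc ∫⁻ t, ‖D t + D' t - (D (t - R) + D' (t - R))‖ₑ
      ≤ ∫⁻ t, (‖D t - D (t - R)‖ₑ + ‖D' t - D' (t - R)‖ₑ) := by
        refine lintegral_mono fun t => ?_
        rw [add_sub_add_comm]
        exact enorm_add_le _ _
    _ = (∫⁻ t, ‖D t - D (t - R)‖ₑ) + ∫⁻ t, ‖D' t - D' (t - R)‖ₑ :=
        lintegral_add_left (by fun_prop) _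
    _ ≤ ENNReal.ofReal (ε / 2 * R) + ENNReal.ofReal (ε / 2 * R) := add_le_add hR hR'
    _ = ENNReal.ofReal (ε * R) := by
        rw [← ENNReal.ofReal_add (by positivity) (by positivity)]
        congr 1
        ring

theorem shiftSublinear_of_integrable {D : ℝ → ℝ} (h : Integrable D) : ShiftSublinear D := by
  intro ε hε
  have hlim : Tendsto (fun R : ℝ => ε * R) atTop atTop := tendsto_id.const_mul_atTop hε
  filter_upwards [hlim.eventually_ge_atTop (2 * (∫⁻ t, ‖D t‖ₑ).toReal)] with R hR
  calc ∫⁻ t, ‖D t - D (t - R)‖ₑ ≤ ∫⁻ t, (‖D t‖ₑ + ‖D (t - R)‖ₑ) :=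
        lintegral_mono fun t => enorm_sub_le
    _ = (∫⁻ t, ‖D t‖ₑ) + ∫⁻ t, ‖D (t - R)‖ₑ := lintegral_add_left' h.1.enorm _
    _ = 2 * ∫⁻ t, ‖D t‖ₑ := by
        rw [lintegral_sub_right_eq_self (fun t => ‖D t‖ₑ) R, two_mul]
    _ = ENNReal.ofReal (2 * (∫⁻ t, ‖D t‖ₑ).toReal) := by
        rw [ENNReal.ofReal_mul zero_le_two, ENNReal.ofReal_toReal h.2.ne]
        simp
    _ ≤ ENNReal.ofReal (ε * R) := ENNReal.ofReal_le_ofReal hR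

/-- The means of a function tending to `0` tend to `0`: beyond some `M` it is at most `ε / 2`, and
the part before `M` contributes a constant independent of `R`. -/
theorem eventually_setLIntegral_antitone_le {g : ℝ → ℝ} (hg : Antitone g)
    (h0 : Tendsto g atTop (𝓝 0)) (X : ℝ) {ε : ℝ} (hε : 0 < ε) :
    ∀ᶠ R : ℝ in atTop,
      ∫⁻ t in Set.Ioc X (X + R), ENNReal.ofReal (g t) ≤ ENNReal.ofReal (ε * R) := by
  obtain ⟨M, hM⟩ := (h0.eventually_le_const (half_pos hε)).exists
  have hgX : 0 ≤ g X := hg.le_of_tendsto h0 X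
  have hlim : Tendsto (fun R : ℝ => ε / 2 * R) atTop atTop :=
    tendsto_id.const_mul_atTop (half_pos hε)
  filter_upwards [hlim.eventually_ge_atTop (g X * max (M - X) 0), eventually_ge_atTop 0]
    with R hR hR0
  calc ∫⁻ t in Set.Ioc X (X + R), ENNReal.ofReal (g t)
      ≤ ∫⁻ t in Set.Ioc X (X + R), ((Set.Ioc X M).indicator (fun _ => ENNReal.ofReal (g X)) t
          + ENNReal.ofReal (ε / 2)) := by
        refine setLIntegral_mono' measurableSet_Ioc fun t ht => ?_
        by_cases htM : t ≤ M
        · rw [Set.indicator_of_mem (show t ∈ Set.Ioc X M from ⟨ht.1, htM⟩)]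
          exact (ENNReal.ofReal_le_ofReal (hg ht.1.le)).trans le_self_add
        · exact (ENNReal.ofReal_le_ofReal ((hg (not_le.1 htM).le).trans hM)).trans le_add_self
    _ ≤ ENNReal.ofReal (g X * max (M - X) 0) + ENNReal.ofReal (ε / 2 * R) := by
        rw [lintegral_add_right _ measurable_const]
        refine add_le_add ?_ ?_
        · refine (setLIntegral_le_lintegral _ _).trans ?_
          rw [lintegral_indicator_const measurableSet_Ioc, Real.volume_Ioc,
            ENNReal.ofReal_mul hgX]
          gcongr
          exact le_max_left _ _
        · rw [setLIntegral_const, Real.volume_Ioc, ENNReal.ofReal_mul (by positivity)]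
          simp
    _ ≤ ENNReal.ofReal (ε / 2 * R) + ENNReal.ofReal (ε / 2 * R) := by gcongr
    _ = ENNReal.ofReal (ε * R) := by
        rw [← ENNReal.ofReal_add (by positivity) (by positivity)]
        congr 1
        ring

/-- A telescoping integral: the integrals of `g` over `(X, ∞)` and `(X + R, ∞)` differ by the one
over `(X, X + R]`. -/
theorem setLIntegral_shift_sub_le {g : ℝ → ℝ} (hg : Antitone g) (h0 : ∀ t, 0 ≤ g t)
    (X : ℝ) {R : ℝ} (hR : 0 ≤ R) :
    ∫⁻ t in Set.Ioi (X + R), ENNReal.ofReal (g (t - R) - g t) ≤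
      ∫⁻ t in Set.Ioc X (X + R), ENNReal.ofReal (g t) := by
  have hgm : Measurable g := hg.measurable
  have key : ∀ M : ℝ, ∫⁻ t in Set.Ioc (X + R) M, ENNReal.ofReal (g (t - R) - g t) ≤
      ∫⁻ t in Set.Ioc X (X + R), ENNReal.ofReal (g t) := by
    intro M
    -- `g` need not be integrable at infinity; truncation at `M` makes the cancellation legitimate.
    have hfin : ∫⁻ t in Set.Ioc (X + R) M, ENNReal.ofReal (g t) ≠ ∞ := by
      refine ne_top_of_le_ne_top (b := ∫⁻ t in Set.Ioc (X + R) M, ENNReal.ofReal (g (X + R)))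
        (by simp [ENNReal.mul_eq_top]) ?_
      exact setLIntegral_mono' measurableSet_Ioc fun t ht =>
        ENNReal.ofReal_le_ofReal (hg ht.1.le)
    refine (ENNReal.add_le_add_iff_right hfin).1 ?_
    calc (∫⁻ t in Set.Ioc (X + R) M, ENNReal.ofReal (g (t - R) - g t)) +
          ∫⁻ t in Set.Ioc (X + R) M, ENNReal.ofReal (g t)
        = ∫⁻ t in Set.Ioc (X + R) M, ENNReal.ofReal (g (t - R)) := by
          rw [← lintegral_add_right _ (by fun_prop)]
          refine lintegral_congr fun t => ?_
          rw [← ENNReal.ofReal_add (sub_nonneg.2 (hg (by linarith))) (h0 t), sub_add_cancel]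
      _ = ∫⁻ t in Set.Ioc X (M - R), ENNReal.ofReal (g t) := by
          rw [← lintegral_indicator measurableSet_Ioc, ← lintegral_indicator measurableSet_Ioc,
            ← lintegral_sub_right_eq_self
              ((Set.Ioc X (M - R)).indicator fun t => ENNReal.ofReal (g t)) R]
          refine lintegral_congr fun t => ?_
          simp only [Set.indicator, Set.mem_Ioc, sub_le_sub_iff_right, lt_sub_iff_add_lt]
      _ ≤ ∫⁻ t in Set.Ioc X (X + R) ∪ Set.Ioc (X + R) M, ENNReal.ofReal (g t) := by
          refine lintegral_mono_set fun t ht => ?_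
          rcases le_or_gt t (X + R) with h | h
          · exact Or.inl ⟨ht.1, h⟩
          · exact Or.inr ⟨h, by linarith [ht.2]⟩
      _ ≤ _ := lintegral_union_le _ _ _
  rw [← lintegral_indicator measurableSet_Ioi]
  have hcov : AECover (volume : Measure ℝ) atTop (fun M : ℝ => Set.Iic M) := aecover_Iic tendsto_id
  refine le_of_tendsto (hcov.lintegral_tendsto_of_countably_generated
    (f := (Set.Ioi (X + R)).indicator fun t => ENNReal.ofReal (g (t - R) - g t))
    ((by fun_prop : Measurable fun t => ENNReal.ofReal (g (t - R) - g t)).indicator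
      measurableSet_Ioi).aemeasurable) (Eventually.of_forall fun M => ?_)
  rw [setLIntegral_indicator measurableSet_Ioi, Set.Ioi_inter_Iic]
  exact key M

/-- On `(X, X + R]` the translate vanishes, and beyond it the difference telescopes. Both parts are
bounded by the integral of `g` over `(X, X + R]`, which is `o(R)`. -/
theorem shiftSublinear_indicator_antitone {g : ℝ → ℝ} (hg : Antitone g)
    (h0 : Tendsto g atTop (𝓝 0)) (X : ℝ) : ShiftSublinear ((Set.Ioi X).indicator g) := by
  have hpos : ∀ t, 0 ≤ g t := fun t => hg.le_of_tendsto h0 t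
  have hgm : Measurable g := hg.measurable
  intro ε hε
  filter_upwards [eventually_setLIntegral_antitone_le hg h0 X (half_pos hε),
    eventually_ge_atTop 0] with R hR hR0
  calc ∫⁻ t, ‖(Set.Ioi X).indicator g t - (Set.Ioi X).indicator g (t - R)‖ₑ
      ≤ ∫⁻ t, ((Set.Ioc X (X + R)).indicator (fun t => ENNReal.ofReal (g t)) t +
          (Set.Ioi (X + R)).indicator (fun t => ENNReal.ofReal (g (t - R) - g t)) t) := by
        refine lintegral_mono fun t => ?_
        rcases le_or_gt t X with h1 | h1
        · have h2 : t - R ≤ X := by linarith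
          simp [Set.indicator, not_lt.2 h1, not_lt.2 h2]
        rcases le_or_gt t (X + R) with h2 | h2
        · have h3 : t - R ≤ X := by linarith
          simp [Set.indicator, h1, h2, not_lt.2 h2, not_lt.2 h3, Real.enorm_of_nonneg (hpos t)]
        · have h3 : X < t - R := by linarith
          have h4 : g t ≤ g (t - R) := hg (by linarith)
          rw [← enorm_neg, neg_sub]
          simp [Set.indicator, h1, h2, not_le.2 h2, h3,
            Real.enorm_of_nonneg (sub_nonneg.2 h4)]
    _ = (∫⁻ t in Set.Ioc X (X + R), ENNReal.ofReal (g t)) +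
          ∫⁻ t in Set.Ioi (X + R), ENNReal.ofReal (g (t - R) - g t) := by
        rw [lintegral_add_left (Measurable.indicator (by fun_prop) measurableSet_Ioc),
          lintegral_indicator measurableSet_Ioc, lintegral_indicator measurableSet_Ioi]
    _ ≤ ENNReal.ofReal (ε / 2 * R) + ENNReal.ofReal (ε / 2 * R) :=
        add_le_add hR ((setLIntegral_shift_sub_le hg hpos X hR0).trans hR)
    _ = ENNReal.ofReal (ε * R) := by
        rw [← ENNReal.ofReal_add (by positivity) (by positivity)]
        congr 1
        ring

/-- The tail of a function that is essentially monotone near `+∞` with an a.e. limit there. -/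
theorem exists_shiftSublinear_tail {φ : ℝ → ℝ} {X a : ℝ}
    (hbdd : EssentiallyOn IsBoundedOn φ Set.univ)
    (hmono : EssentiallyOn IsMonotoneOn φ (Set.Ioi X)) (ha : HasAELimit φ atTop a) :
    ∃ d : ℝ → ℝ, Measurable d ∧ ShiftSublinear d ∧
      ∀ᵐ t, d t = (Set.Ioi X).indicator (fun t => φ t - a) t := by
  obtain ⟨Z₀, hZ₀, C, hC⟩ := hbdd
  obtain ⟨Z₁, hZ₁, hφ⟩ := hmono
  obtain ⟨Z₂, hZ₂, hlim⟩ := ha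
  set Z := Z₀ ∪ Z₁ ∪ Z₂ with hZdef
  have hZ : volume Z = 0 := by simp [hZdef, hZ₀, hZ₁, hZ₂]
  have hZae : ∀ᵐ t : ℝ, t ∉ Z := measure_eq_zero_iff_ae_notMem.1 hZ
  wlog hanti : AntitoneOn φ (Set.Ioi X \ Z₁) generalizing φ a
  · obtain ⟨d, hd, hd', hd''⟩ := this (φ := fun t => -φ t) (a := -a)
      (fun x hx => by simpa using hC x hx)
      (hφ.elim (fun h => Or.inr h.neg) fun h => Or.inl h.neg) hlim.neg
      ((hφ.resolve_right hanti).neg)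
    refine ⟨fun t => -d t, hd.neg, hd'.neg, hd''.mono fun t ht => ?_⟩
    simp only [ht, Set.indicator]
    split_ifs <;> ring
  have hbdd : ∀ t ∈ Set.Ioi X \ Z, |φ t| ≤ C := fun t ht =>
    hC t ⟨trivial, fun h => ht.2 (Or.inl (Or.inl h))⟩
  -- Extending `φ` from off the null set gives a function antitone everywhere, hence Borel
  -- measurable.
  obtain ⟨g, hg, hgφ⟩ := (hanti.mono (show Set.Ioi X \ Z ⊆ Set.Ioi X \ Z₁ from
    fun t ht => ⟨ht.1, fun h => ht.2 (Or.inl (Or.inr h))⟩)).exists_antitone_extension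
    ⟨-C, by rintro _ ⟨t, ht, rfl⟩; exact (abs_le.1 (hbdd t ht)).1⟩
    ⟨C, by rintro _ ⟨t, ht, rfl⟩; exact (abs_le.1 (hbdd t ht)).2⟩
  -- Good points exist arbitrarily far out, so `g`, being monotone, inherits the a.e. limit of `φ`
  -- as a true limit.
  have hdense : ∀ T : ℝ, ∃ t, T < t ∧ t ∉ Z := by
    intro T
    by_contra! h
    have := measure_mono_null (show Set.Ioi T ⊆ Z from fun t ht => h t ht) hZ
    simp at this
  have hga : Tendsto g atTop (𝓝 a) := by
    have hbelow : ∀ t, a ≤ g t := by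
      intro t
      by_contra! hlt
      obtain ⟨T, hT⟩ := eventually_atTop.1
        (eventually_inf_principal.1 (hlim.eventually_const_lt hlt))
      obtain ⟨s, hs, hsZ⟩ := hdense (max T (max t X))
      simp only [max_lt_iff] at hs
      have h1 := hT s hs.1.le (fun h => hsZ (Or.inr h))
      have h2 := hgφ ⟨hs.2.2, hsZ⟩
      have h3 := hg hs.2.1.le
      linarith
    refine tendsto_order.2 ⟨fun c hc => Eventually.of_forall fun t => hc.trans_le (hbelow t),
      fun c hc => ?_⟩
    obtain ⟨T, hT⟩ := eventually_atTop.1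
      (eventually_inf_principal.1 (hlim.eventually_lt_const hc))
    obtain ⟨s, hs, hsZ⟩ := hdense (max T X)
    simp only [max_lt_iff] at hs
    have h1 := hT s hs.1.le (fun h => hsZ (Or.inr h))
    have h2 := hgφ ⟨hs.2, hsZ⟩
    filter_upwards [eventually_ge_atTop s] with t ht
    exact (hg ht).trans_lt (h2 ▸ h1)
  refine ⟨(Set.Ioi X).indicator fun t => g t - a,
    (hg.measurable.sub_const a).indicator measurableSet_Ioi,
    shiftSublinear_indicator_antitone (fun s t hst => sub_le_sub_right (hg hst) a)
      (by simpa using hga.sub_const a) X, hZae.mono fun t ht => ?_⟩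
  by_cases h : t ∈ Set.Ioi X
  · simp only [Set.indicator_of_mem h, hgφ ⟨h, ht⟩]
  · simp only [Set.indicator_of_notMem h]

end ShiftDifference

/-! ### From the activation function to step functions and `C_c(ℝ)`. -/

section OneDimensional

theorem ae_comp_neg {P : ℝ → Prop} (h : ∀ᵐ t, P t) : ∀ᵐ t : ℝ, P (-t) :=
  (Measure.measurePreserving_neg (volume : Measure ℝ)).quasiMeasurePreserving.ae h

theorem volume_preimage_neg_eq_zero {Z : Set ℝ} (hZ : volume Z = 0) :
    volume ((fun t : ℝ => -t) ⁻¹' Z) = 0 :=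
  (Measure.measurePreserving_neg (volume : Measure ℝ)).quasiMeasurePreserving.preimage_null hZ

/-- The jump function with the values `a` on `(0, ∞)` and `b` on `(-∞, 0]`. -/
noncomputable def jump (a b : ℝ) (t : ℝ) : ℝ := if 0 < t then a else b

theorem measurable_jump (a b : ℝ) : Measurable (jump a b) :=
  Measurable.ite measurableSet_Ioi measurable_const measurable_const

theorem abs_jump_le (a b t : ℝ) : |jump a b t| ≤ |a| + |b| := by
  unfold jump
  split_ifs
  · linarith [abs_nonneg b]
  · linarith [abs_nonneg a]

/-- The deviation splits into a right tail, a left tail treated by reflection, and a bounded core on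
`[-X, X]`, which is integrable. -/
theorem shiftSublinear_sub_jump {φ : ℝ → ℝ} (hmeas : AEMeasurable φ)
    (hbdd : EssentiallyOn IsBoundedOn φ Set.univ)
    (hmono : EventuallyEssentially IsMonotoneOn φ)
    {a b : ℝ} (ha : HasAELimit φ atTop a) (hb : HasAELimit φ atBot b) :
    ShiftSublinear (fun t => φ t - jump a b t) := by
  obtain ⟨X, hX, hmono₁, Z, hZ, hmono₂⟩ := hmono
  obtain ⟨d₁, hd₁, hs₁, hd₁φ⟩ := exists_shiftSublinear_tail hbdd hmono₁ ha
  obtain ⟨Z₀, hZ₀, C, hC⟩ := id hbdd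
  obtain ⟨Z₂, hZ₂, hlim⟩ := hb
  have hmaps : Set.MapsTo (fun t : ℝ => -t) (Set.Ioi X \ (fun t : ℝ => -t) ⁻¹' Z)
      (Set.Iio (-X) \ Z) := fun t ht =>
    ⟨Set.mem_Iio.2 (neg_lt_neg (Set.mem_Ioi.1 ht.1)), ht.2⟩
  obtain ⟨d₂, hd₂, hs₂, hd₂φ⟩ := exists_shiftSublinear_tail (φ := fun t => φ (-t)) (X := X) (a := b)
    ⟨_, volume_preimage_neg_eq_zero hZ₀, C, fun t ht => hC (-t) ⟨trivial, ht.2⟩⟩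
    ⟨_, volume_preimage_neg_eq_zero hZ, hmono₂.symm.imp
      (fun h s hs t ht hst => h (hmaps ht) (hmaps hs) (neg_le_neg hst))
      (fun h s hs t ht hst => h (hmaps ht) (hmaps hs) (neg_le_neg hst))⟩
    ⟨_, volume_preimage_neg_eq_zero hZ₂, hlim.comp (tendsto_inf.2
      ⟨tendsto_neg_atTop_atBot.mono_left inf_le_left,
        (tendsto_principal.2 (eventually_inf_principal.2 (Eventually.of_forall fun t ht => ht)))⟩)⟩
  have hcore : ShiftSublinear ((Set.Icc (-X) X).indicator fun t => φ t - jump a b t) := by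
    refine shiftSublinear_of_integrable (IntegrableOn.integrable_indicator ?_ measurableSet_Icc)
    refine Measure.integrableOn_of_bounded (M := C + (|a| + |b|)) (by simp)
      (hmeas.aestronglyMeasurable.sub (measurable_jump a b).aestronglyMeasurable)
      (ae_restrict_of_ae ?_)
    filter_upwards [measure_eq_zero_iff_ae_notMem.1 hZ₀] with t ht
    exact (abs_sub _ _).trans (add_le_add (hC t ⟨trivial, ht⟩) (abs_jump_le a b t))
  refine (hs₁.add (hs₂.comp_neg.add hcore (hd₂.comp measurable_neg)) hd₁).congr_ae ?_
  filter_upwards [hd₁φ, ae_comp_neg hd₂φ] with t h1 h2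
  rw [h1, h2]
  simp only [Set.indicator, Set.mem_Ioi, Set.mem_Icc, neg_neg, jump]
  rcases lt_trichotomy t (-X) with h | h | h
  · have e1 : ¬ X < t := by linarith
    have e2 : X < -t := by linarith
    have e3 : ¬ -X ≤ t := by linarith
    have e4 : ¬ 0 < t := by linarith
    simp [e1, e2, e3, e4]
  · have e1 : ¬ X < t := by linarith
    have e2 : ¬ X < -t := by linarith
    have e3 : -X ≤ t := by linarith
    simp [e1, e2, e3, not_lt.1 e1]
  · have e2 : ¬ X < -t := by linarith
    rcases le_or_gt t X with h' | h'
    · simp [not_lt.2 h', e2, h.le, h']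
    · have e4 : 0 < t := by linarith
      simp [h', e2, not_le.2 h', e4]

/-- The functions on `ℝ` represented by a shallow `φ` network. -/
def realNetworks (φ : ℝ → ℝ) : Submodule ℝ (ℝ → ℝ) :=
  Submodule.span ℝ (Set.range fun q : ℝ × ℝ => fun t => φ (q.1 * t + q.2))

theorem lintegral_comp_mul_left_of_pos (f : ℝ → ℝ≥0∞) {c : ℝ} (hc : 0 < c) :
    ∫⁻ t, f (c * t) = ENNReal.ofReal c⁻¹ * ∫⁻ t, f t := by
  have h := lintegral_map_equiv (μ := (volume : Measure ℝ)) f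
    (Homeomorph.mulLeft₀ c hc.ne').toMeasurableEquiv
  have h' := Real.map_volume_mul_left hc.ne'
  rw [abs_of_pos (inv_pos.2 hc)] at h'
  simp only [Homeomorph.toMeasurableEquiv_coe, Homeomorph.coe_mulLeft₀] at h
  rw [← h, h', lintegral_smul_measure, smul_eq_mul]

theorem ae_comp_mul_sub {P : ℝ → Prop} (h : ∀ᵐ t, P t) {r : ℝ} (hr : r ≠ 0) (c : ℝ) :
    ∀ᵐ t : ℝ, P (r * (t - c)) := by
  have h1 : ∀ᵐ t : ℝ, P (r * t) := by
    have : Measure.QuasiMeasurePreserving (fun t : ℝ => r * t) volume volume :=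
      ⟨measurable_const_mul r, by
        rw [Real.map_volume_mul_left hr]
        exact Measure.smul_absolutelyContinuous⟩
    exact this.ae h
  exact (measurePreserving_sub_right volume c).quasiMeasurePreserving.ae h1

/-- The substitution `t ↦ c + t / r` gives a factor `1 / r` and a shift by `r (d - c)`, so the
integral is `o(r) / r`. -/
theorem ShiftSublinear.tendsto_lintegral {D : ℝ → ℝ} (h : ShiftSublinear D) {c d : ℝ}
    (hcd : c < d) :
    Tendsto (fun r : ℝ => ∫⁻ t, ‖D (r * (t - c)) - D (r * (t - d))‖ₑ) atTop (𝓝 0) := by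
  have key : ∀ r : ℝ, 0 < r → ∫⁻ t, ‖D (r * (t - c)) - D (r * (t - d))‖ₑ =
      ENNReal.ofReal r⁻¹ * ∫⁻ t, ‖D t - D (t - r * (d - c))‖ₑ := by
    intro r hr
    rw [← lintegral_comp_mul_left_of_pos _ hr,
      ← lintegral_sub_right_eq_self (fun t => ‖D (r * t) - D (r * t - r * (d - c))‖ₑ) c]
    refine lintegral_congr fun t => ?_
    ring_nf
  refine ENNReal.tendsto_nhds_zero.2 fun ε hε => ?_
  obtain ⟨δ, hδ, hδε⟩ : ∃ δ : ℝ, 0 < δ ∧ ENNReal.ofReal δ ≤ ε := by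
    rcases eq_or_ne ε ∞ with rfl | hε'
    · exact ⟨1, one_pos, le_top⟩
    · exact ⟨ε.toReal, ENNReal.toReal_pos hε.ne' hε', (ENNReal.ofReal_toReal hε').le⟩
  have hcd' : 0 < d - c := sub_pos.2 hcd
  have hlim : Tendsto (fun r : ℝ => r * (d - c)) atTop atTop := tendsto_id.atTop_mul_const hcd'
  filter_upwards [hlim.eventually (h (δ / (d - c)) (by positivity)), eventually_gt_atTop 0]
    with r hr hr0
  rw [key r hr0]
  refine (mul_le_mul_right hr _).trans (le_of_eq_of_le ?_ hδε)
  rw [← ENNReal.ofReal_mul (by positivity)]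
  congr 1
  field_simp

variable {φ : ℝ → ℝ} {p : ℝ≥0∞} [Fact (1 ≤ p)]

theorem indicator_Ioc_mem_lpClosure (hp : p ≠ ∞) (hmeas : AEMeasurable φ)
    (hbdd : EssentiallyOn IsBoundedOn φ Set.univ)
    (hmono : EventuallyEssentially IsMonotoneOn φ)
    {a b : ℝ} (ha : HasAELimit φ atTop a) (hb : HasAELimit φ atBot b) (hab : a ≠ b)
    {c d : ℝ} (hcd : c < d) :
    (Set.Ioc c d).indicator (fun _ => (1 : ℝ)) ∈ lpClosure (realNetworks φ) p volume := by
  have hs := shiftSublinear_sub_jump hmeas hbdd hmono ha hb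
  obtain ⟨Z₀, hZ₀, C, hC⟩ := hbdd
  set D : ℝ → ℝ := fun t => φ t - jump a b t with hD
  have hDm : AEMeasurable D := hmeas.sub (measurable_jump a b).aemeasurable
  have hDC : ∀ᵐ t, |D t| ≤ C + (|a| + |b|) := by
    filter_upwards [measure_eq_zero_iff_ae_notMem.1 hZ₀] with t ht
    exact (abs_sub _ _).trans (add_le_add (hC t ⟨trivial, ht⟩) (abs_jump_le a b t))
  set K : ℝ := 2 * (C + (|a| + |b|)) with hK
  -- The value `0` for `r ≤ 0` is a default that lets the essential bound `hEK` hold for every `r`.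
  set E : ℝ → ℝ → ℝ := fun r t => if 0 < r then D (r * (t - c)) - D (r * (t - d)) else 0 with hE
  have hEK : ∀ r, ∀ᵐ t, ‖E r t‖ₑ ≤ ENNReal.ofReal K := by
    intro r
    rcases le_or_gt r 0 with hr | hr
    · simp [hE, not_lt.2 hr]
    · filter_upwards [ae_comp_mul_sub hDC hr.ne' c, ae_comp_mul_sub hDC hr.ne' d] with t h1 h2
      simp only [hE, if_pos hr, ← ofReal_norm]
      refine ENNReal.ofReal_le_ofReal ((norm_sub_le _ _).trans ?_)
      rw [hK, two_mul]
      exact add_le_add h1 h2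
  have hElim : Tendsto (fun r => eLpNorm (E r) p volume) atTop (𝓝 0) := by
    refine tendsto_eLpNorm_of_tendsto_lintegral hp ENNReal.ofReal_ne_top hEK
      ((hs.tendsto_lintegral hcd).congr' ?_)
    filter_upwards [eventually_gt_atTop 0] with r hr
    simp only [hE, if_pos hr, hD]
  have hEm : ∀ᶠ r in atTop, MemLp (E r) p volume := by
    filter_upwards [hElim.eventually_lt_const zero_lt_one, eventually_gt_atTop 0] with r h1 hr
    refine ⟨?_, h1.trans ENNReal.one_lt_top⟩
    have hq : ∀ e : ℝ, Measure.QuasiMeasurePreserving (fun t : ℝ => r * (t - e)) volume volume :=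
      fun e => ⟨by fun_prop, Measure.AbsolutelyContinuous.mk fun s hs hs0 => by
        rw [Measure.map_apply (by fun_prop) hs]
        exact measure_eq_zero_iff_ae_notMem.2
          (ae_comp_mul_sub (measure_eq_zero_iff_ae_notMem.1 hs0) hr.ne' e)⟩
    simp only [hE, if_pos hr]
    exact ((hDm.comp_quasiMeasurePreserving (hq c)).sub
      (hDm.comp_quasiMeasurePreserving (hq d))).aestronglyMeasurable
  have hind : MemLp ((Set.Ioc c d).indicator (fun _ => (1 : ℝ))) p volume :=
    memLp_indicator_const p measurableSet_Ioc 1 (Or.inr (by simp))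
  have hne : a - b ≠ 0 := sub_ne_zero.2 hab
  suffices h : (a - b) • (Set.Ioc c d).indicator (fun _ => (1 : ℝ)) ∈
      lpClosure (realNetworks φ) p volume by
    have := Submodule.smul_mem _ (a - b)⁻¹ h
    rwa [smul_smul, inv_mul_cancel₀ hne, one_smul] at this
  set G : ℝ → ℝ → ℝ := fun r => (a - b) • (Set.Ioc c d).indicator (fun _ => (1 : ℝ)) + E r with hG
  refine mem_lpClosure_of_tendsto (l := atTop) (G := G) (hind.const_smul _) ?_ ?_
  · filter_upwards [hEm, eventually_gt_atTop 0] with r hEr hr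
    refine mem_lpClosure_of_mem ?_ ((hind.const_smul _).add hEr)
    -- The jump is invariant under positive dilation, so the jump parts of the two neurons differ by
    -- exactly `a - b` on `(c, d]` and by `0` elsewhere.
    have : G r = (fun t => φ (r * t + -(r * c))) - fun t => φ (r * t + -(r * d)) := by
      ext t
      have h1 : r * t + -(r * c) = r * (t - c) := by ring
      have h2 : r * t + -(r * d) = r * (t - d) := by ring
      simp only [hG, hE, hD, if_pos hr, Pi.add_apply, Pi.sub_apply, Pi.smul_apply, smul_eq_mul,
        h1, h2, jump, Set.indicator, Set.mem_Ioc, mul_pos_iff_of_pos_left hr, sub_pos]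
      by_cases e1 : c < t
      · by_cases e2 : d < t
        · simp [e1, e2, not_le.2 e2]
        · simp only [e1, e2, not_lt.1 e2, if_true, if_false, and_self]
          ring
      · have e2 : ¬ d < t := by linarith
        simp [e1, e2]
    rw [this]
    exact Submodule.sub_mem _ (Submodule.subset_span ⟨(r, -(r * c)), rfl⟩)
      (Submodule.subset_span ⟨(r, -(r * d)), rfl⟩)
  · refine hElim.congr fun r => ?_
    rw [hG, sub_add_cancel_left, eLpNorm_neg]

/-- A continuous function of compact support is a limit of step functions. -/
theorem mem_lpClosure_of_hasCompactSupport {S : Submodule ℝ (ℝ → ℝ)}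
    (hS : ∀ c d : ℝ, c < d → (Set.Ioc c d).indicator (fun _ => (1 : ℝ)) ∈ lpClosure S p volume)
    {f : ℝ → ℝ} (hf : Continuous f) (hfc : HasCompactSupport f) :
    f ∈ lpClosure S p volume := by
  obtain ⟨M, hM⟩ : ∃ M : ℕ, ∀ t, f t ≠ 0 → |t| < M := by
    obtain ⟨R, hR⟩ := hfc.isCompact.isBounded.exists_norm_le
    obtain ⟨M, hM⟩ := exists_nat_gt R
    exact ⟨M, fun t ht => (hR t (subset_tsupport f ht)).trans_lt hM⟩
  refine mem_lpClosure_of_forall_le (hf.memLp_of_hasCompactSupport hfc)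
    (k := (Set.Ioc (-M : ℝ) M).indicator fun _ => 1)
    (memLp_indicator_const p measurableSet_Ioc 1 (Or.inr (by simp))) fun δ hδ => ?_
  obtain ⟨η, hη, hfη⟩ := Metric.uniformContinuous_iff.1
    (hfc.uniformContinuous_of_continuous hf) δ hδ
  obtain ⟨N, hN⟩ := exists_nat_one_div_lt hη
  set L : ℕ := N + 1 with hL
  have hL0 : (0 : ℝ) < L := by positivity
  -- Cells of length `1 / L < η`, each carrying the value of `f` at its right end. Being open on the
  -- left, the cell of `t` has index `⌈t * L⌉ - 1`.
  refine ⟨∑ k ∈ Finset.Ico (-(M * L) : ℤ) (M * L), f ((k + 1) / L) •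
    (Set.Ioc (k / L : ℝ) ((k + 1) / L)).indicator (fun _ => (1 : ℝ)),
    Submodule.sum_mem _ fun k _ => Submodule.smul_mem _ _ (hS _ _ (by gcongr; linarith)),
    Eventually.of_forall fun t => ?_⟩
  have hmem : ∀ k : ℤ, t ∈ Set.Ioc (k / L : ℝ) ((k + 1) / L) ↔ k = ⌈t * L⌉ - 1 := by
    intro k
    rw [Set.mem_Ioc, div_lt_iff₀ hL0, le_div_iff₀ hL0, eq_sub_iff_add_eq, eq_comm,
      Int.ceil_eq_iff]
    push_cast
    simp
  have hsum : (∑ k ∈ Finset.Ico (-(M * L) : ℤ) (M * L), f ((k + 1) / L) •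
      (Set.Ioc (k / L : ℝ) ((k + 1) / L)).indicator (fun _ => (1 : ℝ))) t =
      if t ∈ Set.Ioc (-M : ℝ) M then f (⌈t * L⌉ / L) else 0 := by
    have hiff : t ∈ Set.Ioc (-M : ℝ) M ↔
        ⌈t * L⌉ - 1 ∈ Finset.Ico (-(M * L) : ℤ) (M * L) := by
      rw [Finset.mem_Ico, Int.le_sub_one_iff, Int.lt_ceil, sub_lt_iff_lt_add, Int.lt_add_one_iff,
        Int.ceil_le]
      push_cast
      rw [← neg_mul, mul_lt_mul_iff_left₀ hL0, mul_le_mul_iff_left₀ hL0]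
      rfl
    simp only [Finset.sum_apply, Pi.smul_apply, Set.indicator, smul_eq_mul, mul_ite, mul_one,
      mul_zero, hmem, Finset.sum_ite_eq', hiff]
    push_cast
    simp
  rw [hsum]
  by_cases ht : t ∈ Set.Ioc (-M : ℝ) M
  · rw [if_pos ht, Set.indicator_of_mem ht, mul_one]
    refine (hfη ?_).le
    have h1 := Int.le_ceil (t * L)
    have h2 := Int.ceil_lt_add_one (t * L)
    rw [Real.dist_eq, abs_sub_comm, abs_of_nonneg (by rw [sub_nonneg, le_div_iff₀ hL0]; exact h1)]
    refine lt_trans ?_ hN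
    have hLc : (N : ℝ) + 1 = L := by simp [hL]
    rw [sub_lt_iff_lt_add, div_lt_iff₀ hL0, add_mul, hLc, one_div, inv_mul_cancel₀ hL0.ne']
    linarith
  · rw [if_neg ht, Set.indicator_of_notMem ht, mul_zero, sub_zero, abs_nonpos_iff]
    by_contra h
    have := abs_lt.1 (hM t h)
    exact ht ⟨this.1, this.2.le⟩

end OneDimensional

/-! ### Test functions and density of their derivatives. -/

section SmoothFunctions

/-- `f` is a smooth function of compact support on `ℝ`. -/
def IsTestFunction (f : ℝ → ℝ) : Prop := ContDiff ℝ (⊤ : ℕ∞) f ∧ HasCompactSupport f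

theorem IsTestFunction.deriv {f : ℝ → ℝ} (hf : IsTestFunction f) : IsTestFunction (deriv f) :=
  ⟨(contDiff_infty_iff_deriv.1 hf.1).2, hf.2.deriv⟩

theorem IsTestFunction.exists_support_bound {f : ℝ → ℝ} (hf : IsTestFunction f) :
    ∃ M : ℝ, 0 < M ∧ ∀ t, M ≤ |t| → f t = 0 := by
  obtain ⟨M, hM, h⟩ := hf.2.isCompact.isBounded.exists_pos_norm_le
  refine ⟨M + 1, by linarith, fun t ht => ?_⟩
  by_contra hne
  have := h t (subset_tsupport f hne)
  rw [Real.norm_eq_abs] at this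
  linarith

/-- The primitive from the left of the support vanishes again on the right exactly because the total
integral is `0`. -/
theorem IsTestFunction.exists_antiderivative {g : ℝ → ℝ} (hg : IsTestFunction g)
    (h0 : ∫ t, g t = 0) : ∃ F, IsTestFunction F ∧ _root_.deriv F = g := by
  obtain ⟨M, hM, hgM⟩ := hg.exists_support_bound
  have hgc : Continuous g := hg.1.continuous
  have hd : ∀ t, HasDerivAt (fun u => ∫ s in (-M)..u, g s) (g t) t := fun t =>
    hgc.integral_hasStrictDerivAt (-M) t |>.hasDerivAt
  have hderiv : _root_.deriv (fun u => ∫ s in (-M)..u, g s) = g := funext fun t => (hd t).deriv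
  refine ⟨_, ⟨contDiff_infty_iff_deriv.2 ⟨fun t => (hd t).differentiableAt, ?_⟩, ?_⟩, hderiv⟩
  · rw [hderiv]
    exact hg.1
  · refine HasCompactSupport.intro (isCompact_Icc (a := -M) (b := M)) fun t ht => ?_
    rcases lt_or_ge t (-M) with h | h
    · refine intervalIntegral.integral_zero_ae (Eventually.of_forall fun s hs => hgM s ?_)
      rw [Set.uIoc_of_ge h.le] at hs
      exact (le_neg.1 hs.2).trans (neg_le_abs s)
    · have ht' : M < t := not_le.1 fun h' => ht ⟨h, h'⟩
      rw [intervalIntegral.integral_eq_integral_of_support_subset, h0]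
      intro s hs
      have hsM : |s| < M := not_le.1 fun h' => hs (hgM s h')
      exact ⟨(abs_lt.1 hsM).1, ((abs_lt.1 hsM).2.trans ht').le⟩

/-- The dilation `s χ(s t)` keeps the integral, while its sup norm is `O(s)`. Interpolation bounds
its `L^p` norm by a multiple of `s ^ (1 - 1 / p)`, which needs `p > 1`. -/
theorem tendsto_eLpNorm_spread {p : ℝ≥0∞} [Fact (1 ≤ p)] (hp1 : 1 < p) (hp : p ≠ ∞) {χ : ℝ → ℝ}
    (hχ : Continuous χ) (hχc : HasCompactSupport χ) :
    Tendsto (fun N : ℕ => eLpNorm (fun t => ((N : ℝ) + 1)⁻¹ * χ (((N : ℝ) + 1)⁻¹ * t)) p volume)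
      atTop (𝓝 0) := by
  have h1 : 1 < p.toReal := by
    simpa using (ENNReal.toReal_lt_toReal ENNReal.one_ne_top hp).2 hp1
  obtain ⟨C, hC⟩ := hχc.exists_bound_of_continuous hχ
  set s : ℕ → ℝ := fun N => ((N : ℝ) + 1)⁻¹ with hs
  have hs0 : ∀ N, 0 < s N := fun N => by positivity
  have hslim : Tendsto s atTop (𝓝 0) := by
    simpa [hs] using tendsto_one_div_add_atTop_nhds_zero_nat (𝕜 := ℝ)
  set L := ∫⁻ t, ‖χ t‖ₑ with hL
  have hLt : L ≠ ∞ := (hχ.integrable_of_hasCompactSupport hχc).2.ne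
  have hle : ∀ N, eLpNorm (fun t => s N * χ (s N * t)) p volume ≤
      (ENNReal.ofReal (s N * C) ^ (p.toReal - 1) * L) ^ (1 / p.toReal) := by
    intro N
    refine (eLpNorm_le_interpolate hp (C := ENNReal.ofReal (s N * C)) ENNReal.ofReal_ne_top
      (Eventually.of_forall fun t => ?_)).trans_eq ?_
    · rw [← ofReal_norm, norm_mul, Real.norm_of_nonneg (hs0 N).le]
      exact ENNReal.ofReal_le_ofReal (mul_le_mul_of_nonneg_left (hC _) (hs0 N).le)
    · congr 2
      simp_rw [enorm_mul]
      rw [lintegral_const_mul' _ _ (by finiteness),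
        lintegral_comp_mul_left_of_pos (fun t => ‖χ t‖ₑ) (hs0 N),
        Real.enorm_of_nonneg (hs0 N).le, ← mul_assoc, ← ENNReal.ofReal_mul (hs0 N).le,
        mul_inv_cancel₀ (hs0 N).ne', ENNReal.ofReal_one, one_mul]
  refine tendsto_of_tendsto_of_tendsto_of_le_of_le tendsto_const_nhds ?_ (fun _ => zero_le) hle
  have h2 : Tendsto (fun N => ENNReal.ofReal (s N * C)) atTop (𝓝 0) := by
    simpa using ENNReal.tendsto_ofReal (hslim.mul_const C)
  have h3 := ((ENNReal.continuous_rpow_const (y := p.toReal - 1)).tendsto _).comp h2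
  have h4 := ENNReal.Tendsto.mul_const (b := L) h3 (Or.inr hLt)
  have h5 := ((ENNReal.continuous_rpow_const (y := 1 / p.toReal)).tendsto _).comp h4
  have h6 : 0 < p.toReal := by linarith
  simpa [h1, h6, Function.comp_def] using h5

/-- For `1 < p < ∞`, derivatives of test functions are dense in the test functions. -/
theorem IsTestFunction.exists_tendsto_deriv {p : ℝ≥0∞} [Fact (1 ≤ p)] (hp1 : 1 < p) (hp : p ≠ ∞)
    {f : ℝ → ℝ} (hf : IsTestFunction f) :
    ∃ F : ℕ → ℝ → ℝ, (∀ N, IsTestFunction (F N)) ∧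
      Tendsto (fun N => eLpNorm (f - _root_.deriv (F N)) p volume) atTop (𝓝 0) := by
  let β : ContDiffBump (0 : ℝ) := ⟨1, 2, one_pos, one_lt_two⟩
  set χ : ℝ → ℝ := fun t => (∫ u, f u) * β.normed volume t with hχ
  have hχt : IsTestFunction χ :=
    ⟨contDiff_const.mul β.contDiff_normed, β.hasCompactSupport_normed.mul_left⟩
  have hχi : ∫ t, χ t = ∫ t, f t := by
    rw [hχ, integral_const_mul, β.integral_normed, mul_one]
  -- `κ N` has the integral of `f` but vanishing `L^p` norm, so `f - κ N` has integral `0` and is a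
  -- derivative.
  set κ : ℕ → ℝ → ℝ := fun N t => ((N : ℝ) + 1)⁻¹ * χ (((N : ℝ) + 1)⁻¹ * t) with hκ
  have hκt : ∀ N, IsTestFunction (κ N) := by
    intro N
    refine ⟨contDiff_const.mul (hχt.1.comp (contDiff_const.mul contDiff_id)), ?_⟩
    have : ((N : ℝ) + 1)⁻¹ ≠ 0 := by positivity
    exact (hχt.2.comp_homeomorph (Homeomorph.mulLeft₀ _ this)).mul_left
  have hκi : ∀ N, ∫ t, κ N t = ∫ t, f t := by
    intro N
    have : (0 : ℝ) < (N : ℝ) + 1 := by positivity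
    rw [hκ, integral_const_mul, Measure.integral_comp_mul_left, hχi, inv_inv, abs_of_pos this,
      smul_eq_mul, inv_mul_cancel_left₀ this.ne']
  have hint : ∀ {g : ℝ → ℝ}, IsTestFunction g → Integrable g := fun hg =>
    hg.1.continuous.integrable_of_hasCompactSupport hg.2
  have hex : ∀ N, ∃ F, IsTestFunction F ∧ _root_.deriv F = f - κ N := fun N =>
    IsTestFunction.exists_antiderivative ⟨hf.1.sub (hκt N).1, hf.2.sub (hκt N).2⟩ (by
      change ∫ t, (f t - κ N t) = 0
      rw [integral_sub (hint hf) (hint (hκt N)), hκi, sub_self])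
  choose F hF hFd using hex
  refine ⟨F, hF, (tendsto_eLpNorm_spread hp1 hp hχt.1.continuous hχt.2).congr fun N => ?_⟩
  rw [hFd, sub_sub_cancel]

/-- The mean value inequality in `h`, with `deriv F` Lipschitz; what matters is that `L` is uniform
in `s`. -/
theorem IsTestFunction.exists_taylor_bound {F : ℝ → ℝ} (hF : IsTestFunction F) :
    ∃ L : ℝ, 0 ≤ L ∧ ∀ s h, |F (s + h) - F s - _root_.deriv F s * h| ≤ L * h ^ 2 := by
  obtain ⟨L, hL⟩ := hF.deriv.1.lipschitzWith_of_hasCompactSupport hF.deriv.2 (by simp)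
  refine ⟨L, L.2, fun s h => ?_⟩
  have hd : ∀ u, HasDerivAt (fun u => F (s + u) - F s - _root_.deriv F s * u)
      (_root_.deriv F (s + u) - _root_.deriv F s) u := by
    intro u
    have h1 : HasDerivAt F (_root_.deriv F (s + u)) (s + u) :=
      ((contDiff_infty_iff_deriv.1 hF.1).1 _).hasDerivAt
    have h2 := (h1.comp_const_add s u).sub_const (F s)
    have h3 := h2.sub ((hasDerivAt_id u).const_mul (_root_.deriv F s))
    rw [mul_one] at h3
    exact h3
  have key := (convex_uIcc (0 : ℝ) h).norm_image_sub_le_of_norm_hasDerivWithin_le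
    (C := L * |h|) (fun u _ => (hd u).hasDerivWithinAt) (fun u hu => ?_)
    Set.left_mem_uIcc Set.right_mem_uIcc
  · simpa [mul_assoc, ← sq] using key
  · have h3 := hL.dist_le_mul (s + u) s
    rw [Real.dist_eq, Real.dist_eq, add_sub_cancel_left] at h3
    refine h3.trans (mul_le_mul_of_nonneg_left ?_ L.2)
    simpa using Set.abs_sub_left_of_mem_uIcc hu

end SmoothFunctions

/-! ### Linear functionals on the strip. -/

section Strip

theorem measurableSet_lineTimesCube (n : ℕ) : MeasurableSet (lineTimesCube n) := by
  have : lineTimesCube n = ⋂ i : Fin n, {x | x i.succ ∈ Set.Icc (0 : ℝ) 1} := by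
    ext
    simp [lineTimesCube]
  rw [this]
  refine MeasurableSet.iInter fun i => measurableSet_Icc.preimage ?_
  exact (by fun_prop : Continuous fun x : EuclideanSpace ℝ (Fin (n + 1)) => x i.succ).measurable

/-- The linear functionals with leading coefficient `1` preserve Lebesgue measure on
`ℝ × [0,1]^n`. -/
theorem measurePreserving_inner {n : ℕ} {v : EuclideanSpace ℝ (Fin (n + 1))} (hv : v 0 = 1) :
    MeasurePreserving (fun x => inner ℝ v x) (volume.restrict (lineTimesCube n)) volume := by
  have hm : Measurable fun x : EuclideanSpace ℝ (Fin (n + 1)) => inner ℝ v x :=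
    (by fun_prop : Continuous fun x : EuclideanSpace ℝ (Fin (n + 1)) => inner ℝ v x).measurable
  refine ⟨hm, Measure.ext fun s hs => ?_⟩
  rw [Measure.map_apply hm hs, Measure.restrict_apply (hm hs)]
  have he := (volume_preserving_piFinSuccAbove (fun _ : Fin (n + 1) => ℝ) 0).comp
    (PiLp.volume_preserving_ofLp (Fin (n + 1)))
  set T : Set (ℝ × (Fin n → ℝ)) :=
    {z | z.1 + ∑ i, v i.succ * z.2 i ∈ s} ∩ {z | z.2 ∈ Set.Icc 0 1} with hT
  have hTm : MeasurableSet T :=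
    (hs.preimage (by fun_prop)).inter (measurableSet_Icc.preimage measurable_snd)
  have hpre : (fun x : EuclideanSpace ℝ (Fin (n + 1)) => inner ℝ v x) ⁻¹' s ∩ lineTimesCube n =
      (MeasurableEquiv.piFinSuccAbove (fun _ : Fin (n + 1) => ℝ) 0 ∘
        @WithLp.ofLp 2 (Fin (n + 1) → ℝ)) ⁻¹' T := by
    ext x
    simp [hT, lineTimesCube, PiLp.inner_apply, Fin.sum_univ_succ, hv, Pi.le_def, mul_comm,
      forall_and, Fin.tail, MeasurableEquiv.piFinSuccAbove]
  rw [hpre, he.measure_preimage hTm.nullMeasurableSet, Measure.volume_eq_prod,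
    Measure.prod_apply_symm hTm]
  -- For `y` in the cube the slice is a translate of `s`, so Fubini gives `volume s` times the
  -- volume `1` of the cube.
  have hslice : ∀ y : Fin n → ℝ, volume ((fun t : ℝ => (t, y)) ⁻¹' T) =
      (Set.Icc (0 : Fin n → ℝ) 1).indicator (fun _ => volume s) y := by
    intro y
    by_cases hy : y ∈ Set.Icc (0 : Fin n → ℝ) 1
    · have : (fun t : ℝ => (t, y)) ⁻¹' T = (fun t => t + ∑ i, v i.succ * y i) ⁻¹' s := by
        ext t
        simp only [hT, Set.mem_preimage, Set.mem_inter_iff, Set.mem_ofPred_eq, hy, and_true]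
      rw [this, measure_preimage_add_right, Set.indicator_of_mem hy]
    · have : (fun t : ℝ => (t, y)) ⁻¹' T = ∅ := by
        ext t
        simp only [hT, Set.mem_preimage, Set.mem_inter_iff, Set.mem_ofPred_eq, hy, and_false,
          Set.mem_empty_iff_false]
      rw [this, measure_empty, Set.indicator_of_notMem hy]
  simp_rw [hslice]
  rw [lintegral_indicator_const measurableSet_Icc, Real.volume_Icc_pi]
  simp

end Strip

/-! ### From ridge functions to polynomials and to all of `L^p`. -/

section Multipliers

variable {n : ℕ} {p : ℝ≥0∞}

theorem IsTestFunction.memLp {f : ℝ → ℝ} (hf : IsTestFunction f) : MemLp f p volume :=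
  hf.1.continuous.memLp_of_hasCompactSupport hf.2

theorem eLpNorm_ridge_mul_le {f : ℝ → ℝ} (hf : AEStronglyMeasurable f volume)
    {v : EuclideanSpace ℝ (Fin (n + 1))} (hv : v 0 = 1)
    {u : EuclideanSpace ℝ (Fin (n + 1)) → ℝ} {B : ℝ}
    (hB : ∀ x ∈ lineTimesCube n, |u x| ≤ B) :
    eLpNorm (fun x => f (inner ℝ v x) * u x) p (volume.restrict (lineTimesCube n)) ≤
      ENNReal.ofReal B * eLpNorm f p volume := by
  rw [← eLpNorm_comp_measurePreserving hf (measurePreserving_inner hv)]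
  refine eLpNorm_le_mul_eLpNorm_of_ae_le_mul ?_ p
  filter_upwards [ae_restrict_mem (measurableSet_lineTimesCube n)] with x hx
  rw [norm_mul, mul_comm]
  exact mul_le_mul_of_nonneg_right (hB x hx) (norm_nonneg _)

theorem memLp_ridge_mul {f : ℝ → ℝ} (hf : MemLp f p volume)
    {v : EuclideanSpace ℝ (Fin (n + 1))} (hv : v 0 = 1)
    {u : EuclideanSpace ℝ (Fin (n + 1)) → ℝ} (hu : Continuous u) {B : ℝ}
    (hB : ∀ x ∈ lineTimesCube n, |u x| ≤ B) :
    MemLp (fun x => f (inner ℝ v x) * u x) p (volume.restrict (lineTimesCube n)) :=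
  ⟨(hf.1.comp_measurePreserving (measurePreserving_inner hv)).mul hu.aestronglyMeasurable,
    (eLpNorm_ridge_mul_le hf.1 hv hB).trans_lt (ENNReal.mul_lt_top ENNReal.ofReal_lt_top hf.2)⟩

variable [Fact (1 ≤ p)] {S : Submodule ℝ (EuclideanSpace ℝ (Fin (n + 1)) → ℝ)}

/-- Continuous functions `u`, bounded on `ℝ × [0,1]^n`, such that all products of `u` with a
smooth ridge function of compactly supported profile, in a direction with leading coefficient
`1`, are approximable. -/
structure IsRidgeMultiplier (S : Submodule ℝ (EuclideanSpace ℝ (Fin (n + 1)) → ℝ)) (p : ℝ≥0∞)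
    [Fact (1 ≤ p)] (u : EuclideanSpace ℝ (Fin (n + 1)) → ℝ) : Prop where
  continuous : Continuous u
  bounded : ∃ B : ℝ, 0 ≤ B ∧ ∀ x ∈ lineTimesCube n, |u x| ≤ B
  mem : ∀ f, IsTestFunction f → ∀ v : EuclideanSpace ℝ (Fin (n + 1)), v 0 = 1 →
    (fun x => f (inner ℝ v x) * u x) ∈ lpClosure S p (volume.restrict (lineTimesCube n))

/-- Differentiating a ridge function in its direction. -/
theorem IsRidgeMultiplier.deriv_mem {u : EuclideanSpace ℝ (Fin (n + 1)) → ℝ}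
    (hu : IsRidgeMultiplier S p u) (i : Fin n) {F : ℝ → ℝ} (hF : IsTestFunction F)
    {v : EuclideanSpace ℝ (Fin (n + 1))} (hv : v 0 = 1) :
    (fun x => deriv F (inner ℝ v x) * (x i.succ * u x)) ∈
      lpClosure S p (volume.restrict (lineTimesCube n)) := by
  obtain ⟨B, hB0, hB⟩ := hu.bounded
  obtain ⟨L, hL0, hL⟩ := hF.exists_taylor_bound
  obtain ⟨M, hM0, hM⟩ := hF.exists_support_bound
  obtain ⟨M', hM'0, hM'⟩ := hF.deriv.exists_support_bound
  have hiB : ∀ x ∈ lineTimesCube n, |x i.succ * u x| ≤ B := fun x hx => by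
    rw [abs_mul, abs_of_nonneg (hx i).1]
    exact (mul_le_of_le_one_left (abs_nonneg _) (hx i).2).trans (hB x hx)
  -- As `τ ≤ 1` and `0 ≤ y ≤ 1`, the argument moves by at most `1`; outside `[-R, R]` all three
  -- terms therefore vanish.
  set R : ℝ := max (M + 1) M' with hR
  set k : ℝ → ℝ := (Set.Icc (-R) R).indicator fun _ => L * B with hk
  have hkm : MemLp k p volume :=
    memLp_indicator_const p measurableSet_Icc _ (Or.inr (by simp))
  refine mem_lpClosure_of_forall_le
    (memLp_ridge_mul hF.deriv.memLp hv (Continuous.mul (by fun_prop) hu.continuous) hiB)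
    (hkm.comp_measurePreserving (measurePreserving_inner hv)) fun δ hδ => ?_
  set τ : ℝ := min δ 1 with hτ
  have hτ0 : 0 < τ := lt_min hδ one_pos
  -- Perturbing a coordinate other than the first keeps the leading coefficient `1`, so both terms
  -- of the difference quotient are approximable.
  set w : EuclideanSpace ℝ (Fin (n + 1)) := v + τ • EuclideanSpace.single i.succ 1 with hw
  have hw0 : w 0 = 1 := by simp [hw, hv]
  refine ⟨_, Submodule.smul_mem _ τ⁻¹ (Submodule.sub_mem _ (hu.mem F hF w hw0)
    (hu.mem F hF v hv)), ?_⟩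
  filter_upwards [ae_restrict_mem (measurableSet_lineTimesCube n)] with x hx
  have hwx : inner ℝ w x = inner ℝ v x + τ * x i.succ := by
    simp [hw, inner_add_left, inner_smul_left, EuclideanSpace.inner_single_left]
  simp only [Pi.smul_apply, Pi.sub_apply, smul_eq_mul, Function.comp_apply, hwx]
  set s : ℝ := inner ℝ v x
  set y : ℝ := x i.succ with hy
  have hy0 : 0 ≤ y := (hx i).1
  have hy1 : y ≤ 1 := (hx i).2
  by_cases hs : s ∈ Set.Icc (-R) R
  · rw [hk, Set.indicator_of_mem hs]
    have e : deriv F s * (y * u x) - τ⁻¹ * (F (s + τ * y) * u x - F s * u x) =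
        -(τ⁻¹ * ((F (s + τ * y) - F s - deriv F s * (τ * y)) * u x)) := by
      field_simp
      ring
    rw [e, abs_neg, abs_mul, abs_mul, abs_of_pos (inv_pos.2 hτ0)]
    calc τ⁻¹ * (|F (s + τ * y) - F s - deriv F s * (τ * y)| * |u x|)
        ≤ τ⁻¹ * (L * (τ * y) ^ 2 * B) := by
          gcongr
          · exact hL _ _
          · exact hB x hx
      _ = τ * (L * B) * y ^ 2 := by
          field_simp
      _ ≤ τ * (L * B) := mul_le_of_le_one_right (by positivity) (pow_le_one₀ hy0 hy1)
      _ ≤ δ * (L * B) := by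
          gcongr
          exact min_le_left _ _
  · have hsR : R < |s| := not_le.1 fun h => hs (abs_le.1 h)
    have h1 : M + 1 < |s| := (le_max_left _ _).trans_lt hsR
    have h2 : M' < |s| := (le_max_right _ _).trans_lt hsR
    have h3 : M ≤ |s + τ * y| := by
      have h4 : |τ * y| ≤ 1 := by
        rw [abs_of_nonneg (by positivity)]
        exact mul_le_one₀ (min_le_right _ _) hy0 hy1
      have h5 := abs_sub_abs_le_abs_sub s (-(τ * y))
      rw [abs_neg, sub_neg_eq_add] at h5
      linarith
    rw [hk, Set.indicator_of_notMem hs, hM _ h3, hM _ (by linarith), hM' _ h2.le]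
    simp

/-- `deriv_mem` handles profiles that are derivatives; their `L^p` density and the bound on `x
i.succ * u x` extend this to all test profiles. -/
theorem IsRidgeMultiplier.coord_mul (hp1 : 1 < p) (hp : p ≠ ∞)
    {u : EuclideanSpace ℝ (Fin (n + 1)) → ℝ} (hu : IsRidgeMultiplier S p u) (i : Fin n) :
    IsRidgeMultiplier S p (fun x => x i.succ * u x) := by
  have hc : Continuous fun x : EuclideanSpace ℝ (Fin (n + 1)) => x i.succ * u x :=
    Continuous.mul (by fun_prop) hu.continuous
  obtain ⟨B, hB0, hB⟩ := hu.bounded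
  have hiB : ∀ x ∈ lineTimesCube n, |x i.succ * u x| ≤ B := fun x hx => by
    rw [abs_mul, abs_of_nonneg (hx i).1]
    exact (mul_le_of_le_one_left (abs_nonneg _) (hx i).2).trans (hB x hx)
  refine ⟨hc, ⟨B, hB0, hiB⟩, fun f hf v hv => ?_⟩
  obtain ⟨F, hF, hlim⟩ := hf.exists_tendsto_deriv hp1 hp
  refine mem_lpClosure_of_tendsto (l := (atTop : Filter ℕ)) (memLp_ridge_mul hf.memLp hv hc hiB)
    (Eventually.of_forall fun N => hu.deriv_mem i (hF N) hv) ?_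
  have h1 := ENNReal.Tendsto.const_mul (a := ENNReal.ofReal B) hlim
    (Or.inr ENNReal.ofReal_ne_top)
  rw [mul_zero] at h1
  refine tendsto_of_tendsto_of_tendsto_of_le_of_le tendsto_const_nhds h1 (fun _ => zero_le)
    fun N => ?_
  refine le_of_eq_of_le ?_ (eLpNorm_ridge_mul_le (hf.1.continuous.sub
    (hF N).deriv.1.continuous).aestronglyMeasurable hv hiB)
  congr 1
  ext x
  simp only [Pi.sub_apply]
  ring

theorem isRidgeMultiplier_prod (hp1 : 1 < p) (hp : p ≠ ∞)
    (h1 : IsRidgeMultiplier S p (fun _ => 1)) (m : Fin n → ℕ) :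
    IsRidgeMultiplier S p (fun x => ∏ i, x i.succ ^ m i) := by
  -- Factors that preserve multipliers are closed under products, unlike what is known of the
  -- multipliers themselves.
  let T : Submonoid (EuclideanSpace ℝ (Fin (n + 1)) → ℝ) :=
    { carrier := {w | ∀ u, IsRidgeMultiplier S p u → IsRidgeMultiplier S p (w * u)}
      one_mem' := fun u hu => by rwa [one_mul]
      mul_mem' := fun {w w'} hw hw' u hu => by
        rw [mul_assoc]
        exact hw _ (hw' _ hu) }
  have hT : ∏ i, (fun x : EuclideanSpace ℝ (Fin (n + 1)) => x i.succ) ^ m i ∈ T :=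
    Submonoid.prod_mem _ fun i _ => Submonoid.pow_mem _ (fun u hu => hu.coord_mul hp1 hp i) _
  convert! hT _ h1 using 1
  ext x
  simp

theorem test_mul_polynomial_mem (hp1 : 1 < p) (hp : p ≠ ∞)
    (h1 : IsRidgeMultiplier S p (fun _ => 1)) {f : ℝ → ℝ} (hf : IsTestFunction f)
    (P : MvPolynomial (Fin (n + 1)) ℝ) :
    (fun x : EuclideanSpace ℝ (Fin (n + 1)) => f (x 0) * MvPolynomial.eval (fun i => x i) P) ∈
      lpClosure S p (volume.restrict (lineTimesCube n)) := by
  induction P using MvPolynomial.induction_on' with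
  | monomial m c =>
    -- The power of `x 0` is absorbed into the profile; only the cube coordinates need multipliers.
    have hft : IsTestFunction (fun t => c * (f t * t ^ m 0)) :=
      ⟨contDiff_const.mul (hf.1.mul (contDiff_id.pow _)), (hf.2.mul_right).mul_left⟩
    have := (isRidgeMultiplier_prod hp1 hp h1 (fun i => m i.succ)).mem _ hft
      (EuclideanSpace.single 0 1) (by simp)
    convert this using 1
    ext x
    simp only [MvPolynomial.eval_monomial, EuclideanSpace.inner_single_left, map_one, one_mul]
    rw [Finsupp.prod_fintype _ _ (fun _ => pow_zero _), Fin.prod_univ_succ]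
    ring
  | add P Q hP hQ =>
    convert Submodule.add_mem _ hP hQ using 1
    ext x
    simp only [map_add, Pi.add_apply]
    ring

theorem exists_mvPolynomial_approx {d : ℕ} {K : Set (EuclideanSpace ℝ (Fin d))}
    (hK : IsCompact K) {g : EuclideanSpace ℝ (Fin d) → ℝ} (hg : Continuous g) {δ : ℝ}
    (hδ : 0 < δ) :
    ∃ P : MvPolynomial (Fin d) ℝ, ∀ x ∈ K, |g x - MvPolynomial.eval (fun i => x i) P| ≤ δ := by
  have : CompactSpace K := isCompact_iff_compactSpace.1 hK
  let X : Fin d → C(K, ℝ) := fun i => ⟨fun x => (x : EuclideanSpace ℝ (Fin d)) i, by fun_prop⟩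
  have hsep : (MvPolynomial.aeval (R := ℝ) X).range.SeparatesPoints := by
    intro x y hxy
    obtain ⟨i, hi⟩ : ∃ i, (x : EuclideanSpace ℝ (Fin d)) i ≠ (y : EuclideanSpace ℝ (Fin d)) i := by
      by_contra! h
      exact hxy (Subtype.ext (PiLp.ext h))
    exact ⟨X i, ⟨X i, ⟨MvPolynomial.X i, by simp⟩, rfl⟩, hi⟩
  obtain ⟨⟨q, P, hP⟩, hq⟩ :=
    ContinuousMap.exists_mem_subalgebra_near_continuousMap_of_separatesPoints _ hsep
      ⟨fun x : K => g x, by fun_prop⟩ δ hδ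
  refine ⟨P, fun x hx => ?_⟩
  have hev : q ⟨x, hx⟩ = MvPolynomial.eval (fun i => x i) P := by
    rw [← hP]
    change ContinuousMap.evalAlgHom ℝ ℝ (⟨x, hx⟩ : K) (MvPolynomial.aeval X P) = _
    exact DFunLike.congr_fun (MvPolynomial.algHom_ext
      (f := (ContinuousMap.evalAlgHom ℝ ℝ (⟨x, hx⟩ : K)).comp (MvPolynomial.aeval X))
      (g := MvPolynomial.aeval fun i => x i) fun i => by simp [X]) P
  have := (ContinuousMap.norm_coe_le_norm _ (⟨x, hx⟩ : K)).trans hq.le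
  rw [← hev, abs_sub_comm]
  exact this

/-- A cutoff in `x 0` alone suffices, since the strip is bounded in the other coordinates. It serves
both as a factor of `g` and as the `L^p` weight for the uniform polynomial error. -/
theorem continuous_hasCompactSupport_mem (hp1 : 1 < p) (hp : p ≠ ∞)
    (h1 : IsRidgeMultiplier S p (fun _ => 1)) {g : EuclideanSpace ℝ (Fin (n + 1)) → ℝ}
    (hg : Continuous g) (hgc : HasCompactSupport g) :
    g ∈ lpClosure S p (volume.restrict (lineTimesCube n)) := by
  obtain ⟨M, hM0, hM⟩ := hgc.isCompact.isBounded.exists_pos_norm_le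
  let β : ContDiffBump (0 : ℝ) := ⟨M, M + 1, hM0, by linarith⟩
  have hβ : IsTestFunction β := ⟨β.contDiff, β.hasCompactSupport⟩
  have hv : (EuclideanSpace.single 0 1 : EuclideanSpace ℝ (Fin (n + 1))) 0 = 1 := by simp
  have hβLp : MemLp (fun x : EuclideanSpace ℝ (Fin (n + 1)) => β (x 0)) p
      (volume.restrict (lineTimesCube n)) := by
    have := (hβ.memLp (p := p)).comp_measurePreserving (measurePreserving_inner hv)
    simpa [Function.comp_def, EuclideanSpace.inner_single_left] using this
  have hgβ : ∀ x, g x = β (x 0) * g x := by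
    intro x
    by_cases hx : g x = 0
    · rw [hx, mul_zero]
    · have h2 := (PiLp.norm_apply_le x 0).trans (hM x (subset_tsupport g hx))
      rw [β.one_of_mem_closedBall (by simpa using h2), one_mul]
  have hK : IsCompact (WithLp.toLp 2 '' Set.Icc (fun _ : Fin (n + 1) => -(M + 1))
      fun _ => M + 1) := isCompact_Icc.image (PiLp.continuous_toLp 2 _)
  refine mem_lpClosure_of_forall_le
    ((hg.memLp_of_hasCompactSupport hgc (μ := volume)).restrict _) hβLp fun δ hδ => ?_
  obtain ⟨P, hP⟩ := exists_mvPolynomial_approx hK hg hδ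
  refine ⟨_, test_mul_polynomial_mem hp1 hp h1 hβ P, ?_⟩
  filter_upwards [ae_restrict_mem (measurableSet_lineTimesCube n)] with x hx
  rw [hgβ x, ← mul_sub, abs_mul, abs_of_nonneg β.nonneg, mul_comm]
  by_cases h0 : β (x 0) = 0
  · simp [h0]
  refine mul_le_mul_of_nonneg_right (hP x ⟨x.ofLp, ?_, rfl⟩) β.nonneg
  have hx0 : |x 0| ≤ M + 1 := by
    by_contra! h
    exact h0 (β.zero_of_le_dist (by simpa using h.le))
  refine ⟨fun i => ?_, fun i => ?_⟩
  · induction i using Fin.cases with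
    | zero => exact (abs_le.1 hx0).1
    | succ i => exact le_trans (by linarith) (hx i).1
  · induction i using Fin.cases with
    | zero => exact (abs_le.1 hx0).2
    | succ i => exact (hx i).2.trans (by linarith)

theorem MemLp.mem_lpClosure_of_isRidgeMultiplier_one (hp1 : 1 < p) (hp : p ≠ ∞)
    (h1 : IsRidgeMultiplier S p (fun _ => 1)) {g : EuclideanSpace ℝ (Fin (n + 1)) → ℝ}
    (hg : MemLp g p (volume.restrict (lineTimesCube n))) :
    g ∈ lpClosure S p (volume.restrict (lineTimesCube n)) := by
  refine mem_lpClosure_of_approx hg fun ε hε => ?_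
  obtain ⟨f, hfc, hfε, hf, -⟩ := hg.exists_hasCompactSupport_eLpNorm_sub_le hp hε
  exact ⟨f, continuous_hasCompactSupport_mem hp1 hp h1 hf hfc, hfε⟩

end Multipliers

/-! ### Spans of neurons and the closure in `L^p`. -/

section Networks

/-- The span of the neurons on `ℝ^d`. -/
def networkSpan (d : ℕ) (φ : ℝ → ℝ) : Submodule ℝ (EuclideanSpace ℝ (Fin d) → ℝ) :=
  Submodule.span ℝ (Set.range fun q : ℝ × EuclideanSpace ℝ (Fin d) => neuron φ q.1 q.2)

theorem networkSpan_subset_shallowNetworks {d : ℕ} {φ : ℝ → ℝ}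
    {F : EuclideanSpace ℝ (Fin d) → ℝ} (hF : F ∈ networkSpan d φ) : F ∈ shallowNetworks d φ := by
  obtain ⟨k, t, g, rfl⟩ := Submodule.mem_span_set'.1 hF
  choose q hq using fun i => (g i).2
  refine ⟨k, fun i => (q i).2, t, fun i => (q i).1, ?_⟩
  ext x
  simp [← hq]

theorem comp_inner_mem_networkSpan {d : ℕ} {φ G : ℝ → ℝ} (hG : G ∈ realNetworks φ)
    (v : EuclideanSpace ℝ (Fin d)) : G ∘ (fun x => inner ℝ v x) ∈ networkSpan d φ := by
  have hle : realNetworks φ ≤ (networkSpan d φ).comap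
      (LinearMap.funLeft ℝ ℝ fun x : EuclideanSpace ℝ (Fin d) => inner ℝ v x) := by
    refine Submodule.span_le.2 ?_
    rintro _ ⟨q, rfl⟩
    refine Submodule.subset_span ⟨(q.2, q.1 • v), ?_⟩
    ext x
    simp [neuron, LinearMap.funLeft, inner_smul_left]
  exact hle hG

theorem isUniversalApproximator_of_lpClosure {d : ℕ} {φ : ℝ → ℝ}
    {Ω : Set (EuclideanSpace ℝ (Fin d))} {p : ℝ≥0∞} [Fact (1 ≤ p)]
    (h : ∀ g, MemLp g p (volume.restrict Ω) →
      g ∈ lpClosure (networkSpan d φ) p (volume.restrict Ω)) :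
    IsUniversalApproximator φ Ω p := by
  refine Set.eq_univ_of_forall fun f => EMetric.mem_closure_iff.2 fun ε hε => ?_
  obtain ⟨-, hf⟩ := h f (Lp.memLp f)
  obtain ⟨δ, hδ0, hδ⟩ := exists_between hε
  obtain ⟨G, hG, hGm, hGδ⟩ := hf δ hδ0.ne'
  refine ⟨hGm.toLp G, ⟨G, networkSpan_subset_shallowNetworks hG, hGm.coeFn_toLp⟩, ?_⟩
  rw [Lp.edist_def]
  refine lt_of_le_of_lt (le_of_eq_of_le (eLpNorm_congr_ae ?_) hGδ) hδ
  exact EventuallyEq.rfl.sub hGm.coeFn_toLp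

end Networks

end ShallowNet

/-- The hypothesis `NullMeasurable φ volume` says that `φ` is Lebesgue measurable, and
`Fact (1 ≤ p)`, which follows from `2 ≤ p`, only gives access to the norm on `L^p`. -/
theorem theorem3p5 (n : ℕ) (p : ℝ≥0∞) [Fact (1 ≤ p)] (hp2 : 2 ≤ p) (hp : p < ∞)
    (φ : ℝ → ℝ) (hmeas : NullMeasurable φ (volume : Measure ℝ))
    (hbdd : ShallowNet.EssentiallyOn ShallowNet.IsBoundedOn φ Set.univ)
    (hmono : ShallowNet.EventuallyEssentially ShallowNet.IsMonotoneOn φ)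
    (a b : ℝ) (ha : ShallowNet.HasAELimit φ atTop a) (hb : ShallowNet.HasAELimit φ atBot b)
    (hab : a ≠ b) :
    ShallowNet.IsUniversalApproximator φ (ShallowNet.lineTimesCube n) p := by
  refine ShallowNet.isUniversalApproximator_of_lpClosure fun g hg =>
    ShallowNet.MemLp.mem_lpClosure_of_isRidgeMultiplier_one (ENNReal.one_lt_two.trans_le hp2) hp.ne
      ⟨continuous_const, ⟨1, zero_le_one, by simp⟩, fun f hf v hv => ?_⟩ hg
  simp only [mul_one]
  exact ShallowNet.comp_mem_lpClosure (ShallowNet.measurePreserving_inner hv)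
    (fun G hG => ShallowNet.comp_inner_mem_networkSpan hG v)
    (ShallowNet.mem_lpClosure_of_hasCompactSupport
      (fun c d hcd => ShallowNet.indicator_Ioc_mem_lpClosure hp.ne hmeas.aemeasurable hbdd hmono
        ha hb hab hcd) hf.1.continuous hf.2)
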